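/- Let $G$ and $H$ be locally compact (Hausdorff) groups and let $\Pi\colon H\to G$ be an injective continuous homomorphism. Let $L^\infty(G)=L^1(G)^*$ be the von Neumann algebra of (classes modulo locally null sets of) bounded measurable functions on $G$ with respect to Haar measure, with positive cone $L^\infty(G)_+$. Let $\alpha\colon L^\infty(G)\to L^\infty(G)\,\bar\otimes\,L^\infty(H)\cong L^\infty(G\times H)$, $\alpha(f)(g,h)=f(g\,\Pi(h))$, be the action of $H$ on $L^\infty(G)$ associated to $\Pi$. An element $f\in L^\infty(G)_+$ is called integrable for $\alpha$ if $\int_H f(\,\cdot\,\Pi(h))\,dh$ (with $dh$ a left Haar measure on $H$) exists in $L^\infty(G)_+$, i.e. if there is $y\in L^\infty(G)_+$ such that $$\int_H\Bigl(\int_G\omega(g)\,f(g\,\Pi(h))\,dg\Bigr)dh=\int_G\omega(g)\,y(g)\,dg\qquad\text{for all }\omega\in L^1(G)_+ ,$$ and the action $\alpha$ is called integrable if the set of its integrable elements is $\sigma$-weakly dense in $L^\infty(G)_+$ (the $\sigma$-weak topology being the weak-$*$ topology of $L^\infty(G)=L^1(G)^*$). Then the image of $\Pi$ is closed in $G$ and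 $\Pi$ is a homeomorphism of $H$ onto $\mathrm{im}\,\Pi$ if and only if the action $\alpha$ is integrable. -/

import Mathlib

open MeasureTheory Filter Topology
open scoped ENNReal ComplexOrder

namespace LCG

noncomputable section

section LInfty

variable {G : Type*} [MeasurableSpace G]

/-- `L^∞(G)`. It is used for `μ` an inner regular Haar measure, whose null Borel sets are exactly
the locally null Borel sets; then this is the usual von Neumann algebra `L^∞(G) = L¹(G)^*`, with
no countability assumption on the group `G`. -/
abbrev LInf (μ : Measure G) : Type _ := Lp ℂ ∞ μ

/-- `L¹(G)`, the predual of `L^∞(G)`. -/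
abbrev LOne (μ : Measure G) : Type _ := Lp ℂ 1 μ

/-- The pairing `⟨ω, f⟩ = ∫ ω f dμ` of the predual `L¹(G)` with `L^∞(G)`. -/
def pairing (μ : Measure G) (ω : LOne μ) (f : LInf μ) : ℂ := ∫ g, ω g * f g ∂μ

/-- The positive cone `L^∞(G)_+`. -/
def LInfPos (μ : Measure G) : Set (LInf μ) := {f | ∀ᵐ g ∂μ, (0 : ℂ) ≤ f g}

/-- The positive normal functionals on `L^∞(G)`, i.e. the positive cone of `L¹(G)`. -/
def LOnePos (μ : Measure G) : Set (LOne μ) := {ω | ∀ᵐ g ∂μ, (0 : ℂ) ≤ ω g}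

/-- The `σ`-weak topology of `L^∞(G)`: the weakest topology for which all the functionals
`f ↦ ⟨ω, f⟩` with `ω ∈ L¹(G)` are continuous. -/
@[reducible] def sigmaWeak (μ : Measure G) : TopologicalSpace (LInf μ) :=
  TopologicalSpace.induced (fun f (ω : LOne μ) => pairing μ ω f) Pi.topologicalSpace

end LInfty

section Integrable

variable {G H : Type*} [MeasurableSpace G] [MeasurableSpace H]

/-- The value at `ω` of `(id ⊗ h_L) α(f)`, an element of the extended positive part of `L^∞(G)`:
the left Haar weight `u ↦ ∫ u dν` of `L^∞(H)_+` applied to the function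
`(ω ⊗ id) α(f) : h ↦ ⟨ω, α_h(f)⟩` (for a continuous action, a continuous bounded function,
nonnegative when `ω` and `f` are positive). -/
def weightValue (μ : Measure G) (ν : Measure H) (α : H → LInf μ → LInf μ)
    (f : LInf μ) (ω : LOne μ) : ℝ≥0∞ :=
  ∫⁻ h, ENNReal.ofReal (pairing μ ω (α h f)).re ∂ν

/-- The integrable elements of an action `α` of `H` on `L^∞(G)`: those `f ∈ L^∞(G)_+` for which
`(id ⊗ h_L) α(f)` belongs to `L^∞(G)_+`, i.e. is given by some `y ∈ L^∞(G)_+`. -/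
def integrableElements (μ : Measure G) (ν : Measure H) (α : H → LInf μ → LInf μ) :
    Set (LInf μ) :=
  {f | f ∈ LInfPos μ ∧ ∃ y ∈ LInfPos μ, ∀ ω ∈ LOnePos μ,
    weightValue μ ν α f ω = ENNReal.ofReal (pairing μ ω y).re}

/-- The action `α` is integrable: its integrable elements are `σ`-weakly dense
in `L^∞(G)_+`. -/
def IsIntegrableAction (μ : Measure G) (ν : Measure H) (α : H → LInf μ → LInf μ) : Prop :=
  LInfPos μ ⊆ @closure (LInf μ) (sigmaWeak μ) (integrableElements μ ν α)

end Integrable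

section Translation

variable {G : Type*} [Group G] [TopologicalSpace G] [IsTopologicalGroup G]
  [LocallyCompactSpace G] [MeasurableSpace G] [BorelSpace G]

theorem quasiMeasurePreserving_mul_const (μ : Measure G) [μ.IsHaarMeasure] [μ.InnerRegular]
    (a : G) : Measure.QuasiMeasurePreserving (fun g => g * a) μ μ := by
  refine ⟨(continuous_mul_const a).measurable, ?_⟩
  rw [Measure.map_right_mul_eq_modularCharacterFun_smul]
  exact Measure.smul_absolutelyContinuous

theorem eLpNorm_top_rightTranslate (μ : Measure G) [μ.IsHaarMeasure] [μ.InnerRegular]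
    (a : G) (f : LInf μ) :
    eLpNorm (f.1.compQuasiMeasurePreserving _ (quasiMeasurePreserving_mul_const μ a)) ∞ μ < ∞ := by
  have h := quasiMeasurePreserving_mul_const μ a
  rw [eLpNorm_congr_ae (AEEqFun.coeFn_compQuasiMeasurePreserving f.1 h), eLpNorm_exponent_top]
  refine lt_of_le_of_lt (eLpNormEssSup_le_of_ae_enorm_bound (C := eLpNormEssSup f μ)
    (h.ae (ae_le_eLpNormEssSup (f := f) (μ := μ)))) ?_
  simpa [eLpNorm_exponent_top] using Lp.eLpNorm_lt_top f

/-- Right translation by `a` on `L^∞(G)`: the class of `g ↦ f (g * a)`. -/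
def rightTranslate (μ : Measure G) [μ.IsHaarMeasure] [μ.InnerRegular] (a : G) (f : LInf μ) :
    LInf μ :=
  ⟨f.1.compQuasiMeasurePreserving _ (quasiMeasurePreserving_mul_const μ a),
    Lp.mem_Lp_iff_eLpNorm_lt_top.2 (eLpNorm_top_rightTranslate μ a f)⟩

theorem coeFn_rightTranslate (μ : Measure G) [μ.IsHaarMeasure] [μ.InnerRegular] (a : G)
    (f : LInf μ) : rightTranslate μ a f =ᵐ[μ] fun g => f (g * a) :=
  AEEqFun.coeFn_compQuasiMeasurePreserving f.1 (quasiMeasurePreserving_mul_const μ a)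

variable {H : Type*} [Group H] [TopologicalSpace H]

/-- The action of `H` on `L^∞(G)` associated to a continuous homomorphism `φ : H → G`:
the pull-back `α_h(f)(g) = α(f)(g, h) = f (g * φ h)` of the right action `g · h = g * φ h`. -/
def associatedAction (μ : Measure G) [μ.IsHaarMeasure] [μ.InnerRegular] (φ : H →ₜ* G) :
    H → LInf μ → LInf μ :=
  fun h f => rightTranslate μ (φ h) f

end Translation

end

end LCG

/-! The theorem reduces to: the action is integrable if and only if `φ` is proper. For continuous
injective `φ`, properness is the same as being a closed embedding.

Integrable implies proper. Density yields an integrable `f` with nonzero integral over a compact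
neighbourhood `L` of `1`. For compact `K`, test the weight of `f` on the indicator of `L * K⁻¹`:
each `h` with `φ h ∈ K` contributes at least a fixed positive amount, since the modular character is
bounded below on `K`. The total is finite, so `φ ⁻¹' K` has finite measure
(`measure_preimage_lt_top`). Applied to a slightly larger compact set this bounds the measure of `φ
⁻¹' K * V`, and a packing argument (`isCompact_of_measure_mul_lt_top`) makes `φ ⁻¹' K` compact.

Proper implies integrable. If `k ≥ 0` is continuous with compact support, its orbit integral `y g =
∫ k (g * φ h) dh` is continuous and bounded, and Tonelli identifies it as the element witnessing
integrability of `k`. Such `k` are `σ`-weakly dense in the positive cone. The Haar measures need not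
be `σ`-finite: each `ω ∈ L¹` gives a finite inner regular measure `|ω| μ`, which is a countable sum
of pieces carried by compact sets, and on each piece Fubini is applied to a continuous compactly
supported integrand. -/

namespace LCG

open scoped Pointwise

/-! ### Packing in groups and inner regularity of densities -/

/-- A closed subset `S` of a locally compact group such that `S * V` has finite Haar measure for
some compact neighbourhood `V` of `1` is compact. -/
theorem isCompact_of_measure_mul_lt_top {H : Type*} [Group H] [TopologicalSpace H]
    [IsTopologicalGroup H] [T2Space H] [MeasurableSpace H] [BorelSpace H]
    (ν : Measure H) [ν.IsHaarMeasure] {S V : Set H} (hS : IsClosed S) (hV : IsCompact V)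
    (hV1 : V ∈ 𝓝 (1 : H)) (hfin : ν (S * V) < ∞) : IsCompact S := by
  by_contra hne
  have step : ∀ t : Finset H, (∀ x ∈ t, x ∈ S) →
      ∃ y, y ∈ S ∧ ∀ x ∈ t, Disjoint (x • V) (y • V) := by
    intro t _
    -- `x • V` meets `y • V` only if `y ∈ x • (V * V⁻¹)`, so any `y ∈ S` outside this compact set
    -- works; one exists because `S` is closed and not compact.
    have hcpt : IsCompact ((t : Set H) * (V * V⁻¹)) :=
      t.finite_toSet.isCompact.mul (hV.mul hV.inv)
    have hnot : ¬ S ⊆ (t : Set H) * (V * V⁻¹) := fun h => hne (hcpt.of_isClosed_subset hS h)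
    obtain ⟨y, hyS, hy⟩ := Set.not_subset.1 hnot
    refine ⟨y, hyS, fun x hx => Set.disjoint_left.2 ?_⟩
    rintro _ ⟨v, hv, rfl⟩ ⟨w, hw, hvw⟩
    refine hy ⟨x, hx, v * w⁻¹, ⟨v, hv, w⁻¹, by simpa using hw, rfl⟩, ?_⟩
    simp only [smul_eq_mul] at hvw ⊢
    rw [← mul_assoc, ← hvw, mul_inv_cancel_right]
  have : Std.Symm (fun x y : H => Disjoint (x • V) (y • V)) := ⟨fun _ _ h => h.symm⟩
  obtain ⟨s, hsS, hs⟩ := exists_seq_of_forall_finset_exists' (fun x => x ∈ S)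
    (fun x y => Disjoint (x • V) (y • V)) step
  have hpos : ν V ≠ 0 := (Measure.measure_pos_of_mem_nhds ν hV1).ne'
  have hmeas : ν (⋃ n, s n • V) = ∞ := by
    rw [measure_iUnion hs fun n => (hV.smul (s n)).measurableSet]
    simp_rw [measure_smul]
    exact ENNReal.tsum_const_eq_top_of_ne_zero hpos
  have hsub : (⋃ n, s n • V) ⊆ S * V := by
    refine Set.iUnion_subset fun n => ?_
    rintro _ ⟨v, hv, rfl⟩
    exact ⟨s n, hsS n, v, hv, rfl⟩
  exact (hmeas ▸ measure_mono hsub).not_gt hfin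

/-- A finite measure with a density with respect to an inner regular measure is inner regular. -/
theorem innerRegular_withDensity {X : Type*} [TopologicalSpace X] [MeasurableSpace X]
    (μ : Measure X) [μ.InnerRegularCompactLTTop] {F : X → ℝ≥0∞} (hF : Measurable F)
    (hfin : ∫⁻ x, F x ∂μ ≠ ∞) [T2Space X] [OpensMeasurableSpace X] :
    (μ.withDensity F).InnerRegular := by
  refine ⟨fun A hA r hr => ?_⟩
  have : IsFiniteMeasure (μ.withDensity F) := isFiniteMeasure_withDensity hfin
  -- By Markov's inequality the `B n` have finite `μ`-measure, so inner regularity of `μ` applies to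
  -- them; they exhaust `A` up to `{F = 0}`, which the density ignores.
  let B : ℕ → Set X := fun n => A ∩ {x | ((n : ℝ≥0∞) + 1)⁻¹ ≤ F x}
  have hBm : ∀ n, MeasurableSet (B n) := fun n => hA.inter (hF measurableSet_Ici)
  have hBmono : Monotone B := by
    intro i j hij x hx
    have h : ((j : ℝ≥0∞) + 1)⁻¹ ≤ ((i : ℝ≥0∞) + 1)⁻¹ := by gcongr
    exact ⟨hx.1, h.trans hx.2⟩
  have hBU : μ.withDensity F (⋃ n, B n) = μ.withDensity F A := by
    refine le_antisymm (measure_mono (Set.iUnion_subset fun n => Set.inter_subset_left)) ?_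
    have hsub : A ⊆ (⋃ n, B n) ∪ {x | F x = 0} := by
      intro x hx
      by_cases h0 : F x = 0
      · exact Or.inr h0
      · left
        obtain ⟨n, hn⟩ := ENNReal.exists_inv_nat_lt h0
        refine Set.mem_iUnion.2 ⟨n, hx, le_trans ?_ hn.le⟩
        exact ENNReal.inv_le_inv.2 le_self_add
    refine (measure_mono hsub).trans ((measure_union_le _ _).trans ?_)
    have h0 : μ.withDensity F {x | F x = 0} = 0 := by
      have hm : MeasurableSet {x | F x = 0} := hF (measurableSet_singleton 0)
      rw [withDensity_apply _ hm]
      exact (setLIntegral_congr_fun hm (fun x hx => hx)).trans lintegral_zero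
    rw [h0, add_zero]
  rw [← hBU, hBmono.measure_iUnion] at hr
  obtain ⟨n, hn⟩ := lt_iSup_iff.1 hr
  have hμB : μ (B n) ≠ ∞ := by
    have h1 : ((n : ℝ≥0∞) + 1)⁻¹ * μ {x | ((n : ℝ≥0∞) + 1)⁻¹ ≤ F x} ≤ ∫⁻ x, F x ∂μ :=
      mul_meas_ge_le_lintegral hF _
    intro h
    have h2 : μ {x | ((n : ℝ≥0∞) + 1)⁻¹ ≤ F x} = ∞ :=
      top_unique (h ▸ measure_mono Set.inter_subset_right)
    rw [h2, ENNReal.mul_top (by simp)] at h1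
    exact hfin (top_unique h1)
  -- Absolute continuity of the integral: sets of `μ`-measure below `δ` carry less than the gap
  -- between `r` and the mass of `B n`.
  obtain ⟨δ, hδ0, hδ⟩ := exists_pos_setLIntegral_lt_of_measure_lt hfin
    (tsub_pos_of_lt hn).ne'
  obtain ⟨K, hKB, hK, hKlt⟩ := (hBm n).exists_isCompact_sdiff_lt hμB hδ0.ne'
  refine ⟨K, hKB.trans Set.inter_subset_left, hK, ?_⟩
  have h3 : μ.withDensity F (B n \ K) < μ.withDensity F (B n) - r := by
    rw [withDensity_apply _ ((hBm n).diff hK.measurableSet)]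
    exact hδ _ hKlt
  by_contra! hle
  have h4 : μ.withDensity F (B n) ≤ μ.withDensity F K + μ.withDensity F (B n \ K) := by
    rw [← measure_union Set.disjoint_sdiff_right ((hBm n).diff hK.measurableSet),
      Set.union_sdiff_cancel hKB]
  have h5 : μ.withDensity F (B n) ≤ r + μ.withDensity F (B n \ K) :=
    h4.trans (add_le_add_left hle _)
  have h6 := tsub_le_iff_left.2 h5
  exact h6.not_gt h3

/-! ### Bounds for the modular character on compact sets -/

section Bounds

variable {G : Type*} [Group G] [TopologicalSpace G] [IsTopologicalGroup G]
  [LocallyCompactSpace G] [T2Space G] [MeasurableSpace G] [BorelSpace G]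

/-- The modular character is bounded above on compact sets. -/
theorem exists_modularCharacterFun_le (μ : Measure G) [μ.IsHaarMeasure] [μ.InnerRegular]
    {K : Set G} (hK : IsCompact K) :
    ∃ C : ℝ≥0∞, C ≠ ∞ ∧ ∀ k ∈ K, (Measure.modularCharacterFun k : ℝ≥0∞) ≤ C := by
  obtain ⟨V, hV, hV1⟩ := exists_compact_mem_nhds (1 : G)
  have hpos : μ V ≠ 0 := (Measure.measure_pos_of_mem_nhds μ hV1).ne'
  have hfin : μ (V * K⁻¹) ≠ ∞ := (hV.mul hK.inv).measure_ne_top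
  -- The modular character at `k` scales `μ V` to the measure of `V * k⁻¹`, which lies in `V * K⁻¹`.
  refine ⟨μ (V * K⁻¹) / μ V, ENNReal.div_ne_top hfin hpos, fun k hk => ?_⟩
  rw [ENNReal.le_div_iff_mul_le (Or.inl hpos) (Or.inr hfin)]
  have h := congrArg (fun m : Measure G => m V)
    (Measure.map_right_mul_eq_modularCharacterFun_smul μ k)
  simp only [Measure.map_apply (measurable_mul_const k) hV.measurableSet] at h
  have h' : (Measure.modularCharacterFun k : ℝ≥0∞) * μ V = μ ((· * k) ⁻¹' V) := h.symm
  rw [h']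
  refine measure_mono fun x hx => ⟨x * k, hx, k⁻¹, Set.inv_mem_inv.2 hk, by simp⟩

/-- The modular character is bounded away from zero on compact sets. -/
theorem exists_le_modularCharacterFun (μ : Measure G) [μ.IsHaarMeasure] [μ.InnerRegular]
    {K : Set G} (hK : IsCompact K) :
    ∃ c : ℝ≥0∞, c ≠ 0 ∧ ∀ k ∈ K, c ≤ (Measure.modularCharacterFun k : ℝ≥0∞) := by
  obtain ⟨C, hC, h⟩ := exists_modularCharacterFun_le μ hK.inv
  refine ⟨C⁻¹, ENNReal.inv_ne_zero.2 hC, fun k hk => ?_⟩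
  have h1 := h k⁻¹ (Set.inv_mem_inv.2 hk)
  have h2 : Measure.modularCharacterFun k * Measure.modularCharacterFun k⁻¹ = 1 := by
    rw [← Measure.modularCharacterFun_map_mul, mul_inv_cancel, Measure.modularCharacterFun_map_one]
  rw [ENNReal.inv_le_iff_inv_le]
  refine le_trans (le_of_eq ?_) h1
  rw [eq_comm]
  refine ENNReal.eq_inv_of_mul_eq_one_left ?_
  rw [mul_comm]
  exact_mod_cast h2

end Bounds

/-! ### Testing against indicator functions -/

section Indicator

variable {G : Type*} [MeasurableSpace G] {μ : Measure G}

theorem indicatorConstLp_mem_LOnePos {L : Set G} (hL : MeasurableSet L) (hμL : μ L ≠ ∞) :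
    (indicatorConstLp 1 hL hμL (1 : ℂ) : LOne μ) ∈ LOnePos μ := by
  filter_upwards [indicatorConstLp_coeFn (p := 1) (hs := hL) (hμs := hμL) (c := (1 : ℂ))] with g hg
  rw [hg]
  exact Set.indicator_nonneg (fun _ _ => zero_le_one) g

/-- The pairing of a positive bounded function with the indicator of a set of finite measure. -/
theorem ofReal_pairing_indicatorConstLp {L : Set G} (hL : MeasurableSet L) (hμL : μ L ≠ ∞)
    {f : LInf μ} (hf : f ∈ LInfPos μ) :
    ENNReal.ofReal (pairing μ (indicatorConstLp 1 hL hμL (1 : ℂ)) f).re =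
      ∫⁻ g in L, ENNReal.ofReal (f g).re ∂μ := by
  have h1 : pairing μ (indicatorConstLp 1 hL hμL (1 : ℂ)) f = ∫ g in L, f g ∂μ := by
    rw [pairing, ← integral_indicator hL]
    refine integral_congr_ae ?_
    filter_upwards [indicatorConstLp_coeFn (p := 1) (hs := hL) (hμs := hμL) (c := (1 : ℂ))]
      with g hg
    rw [hg]
    by_cases h : g ∈ L <;> simp [h]
  have : IsFiniteMeasure (μ.restrict L) := ⟨by simpa using hμL.lt_top⟩
  have hint : Integrable (fun g => f g) (μ.restrict L) :=
    ((Lp.memLp f).restrict L).integrable le_top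
  have h2 : (∫ g in L, f g ∂μ).re = ∫ g in L, (f g).re ∂μ := (integral_re hint).symm
  have hre : Integrable (fun g => (f g).re) (μ.restrict L) := hint.re
  rw [h1, h2, ofReal_integral_eq_lintegral_ofReal hre]
  · filter_upwards [ae_restrict_of_ae hf] with g hg
    exact (Complex.le_def.1 hg).1

/-- An integrable action has an integrable element which does not vanish on a given set of positive
measure. -/
theorem IsIntegrableAction.exists_lintegral_ne_zero {H : Type*} [MeasurableSpace H]
    {ν : Measure H} {α : H → LInf μ → LInf μ} (hα : IsIntegrableAction μ ν α)
    {L : Set G} (hL : MeasurableSet L) (hμL : μ L ≠ ∞) (hL0 : μ L ≠ 0) :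
    ∃ f ∈ integrableElements μ ν α, ∫⁻ g in L, ENNReal.ofReal (f g).re ∂μ ≠ 0 := by
  let ω : LOne μ := indicatorConstLp 1 hL hμL (1 : ℂ)
  let one : LInf μ := (memLp_top_const (1 : ℂ)).toLp (fun _ => (1 : ℂ))
  have hone : one =ᵐ[μ] fun _ => (1 : ℂ) := MemLp.coeFn_toLp _
  have honepos : one ∈ LInfPos μ := by
    filter_upwards [hone] with g hg
    rw [hg]; exact zero_le_one
  let _ : TopologicalSpace (LInf μ) := sigmaWeak μ
  have hcont : Continuous[sigmaWeak μ, _] fun f : LInf μ => (pairing μ ω f).re := by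
    have h1 : Continuous[sigmaWeak μ, _] fun (f : LInf μ) (ω : LOne μ) => pairing μ ω f :=
      continuous_induced_dom
    exact Complex.continuous_re.comp ((continuous_apply ω).comp h1)
  have hopen : IsOpen[sigmaWeak μ] {f : LInf μ | 0 < (pairing μ ω f).re} :=
    isOpen_Ioi.preimage hcont
  have hmem : one ∈ {f : LInf μ | 0 < (pairing μ ω f).re} := by
    refine ENNReal.ofReal_pos.1 ?_
    rw [ofReal_pairing_indicatorConstLp hL hμL honepos]
    have : ∫⁻ g in L, ENNReal.ofReal (one g).re ∂μ = ∫⁻ g in L, 1 ∂μ := by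
      refine lintegral_congr_ae ?_
      filter_upwards [ae_restrict_of_ae hone] with g hg
      simp [hg]
    rw [this, setLIntegral_one]
    exact pos_iff_ne_zero.2 hL0
  -- The constant `1` lies in the `σ`-weak closure, so this open neighbourhood of it contains an
  -- integrable element.
  obtain ⟨f, hf, hfi⟩ := (@mem_closure_iff _ (sigmaWeak μ) _ _).1 (hα honepos) _ hopen hmem
  refine ⟨f, hfi, ?_⟩
  rw [← ofReal_pairing_indicatorConstLp hL hμL hfi.1]
  exact (ENNReal.ofReal_pos.2 hf).ne'

end Indicator

/-! ### Integrable actions come from proper homomorphisms -/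

section Closed

variable {G : Type*} [Group G] [TopologicalSpace G] [IsTopologicalGroup G]
  [LocallyCompactSpace G] [T2Space G] [MeasurableSpace G] [BorelSpace G]
  {H : Type*} [Group H] [TopologicalSpace H]

omit [T2Space G] in
theorem rightTranslate_mem_LInfPos (μ : Measure G) [μ.IsHaarMeasure] [μ.InnerRegular] (a : G)
    {f : LInf μ} (hf : f ∈ LInfPos μ) : rightTranslate μ a f ∈ LInfPos μ := by
  filter_upwards [coeFn_rightTranslate μ a f, (quasiMeasurePreserving_mul_const μ a).ae hf]
    with g h1 h2
  rw [h1]; exact h2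

/-- Substituting `g * k` for `g` produces the modular factor, and `g * k ∈ L` forces `g ∈ L * K⁻¹`.
The right-hand domain does not depend on `k`, so one test functional serves all of `K`. -/
theorem le_setLIntegral_rightTranslate (μ : Measure G) [μ.IsHaarMeasure] [μ.InnerRegular]
    {L K : Set G} (hL : IsCompact L) (hK : IsCompact K) {k : G} (hk : k ∈ K) (f : LInf μ) :
    (Measure.modularCharacterFun k : ℝ≥0∞) * ∫⁻ g in L, ENNReal.ofReal (f g).re ∂μ ≤
      ∫⁻ g in L * K⁻¹, ENNReal.ofReal (rightTranslate μ k f g).re ∂μ := by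
  have hF : Measurable fun g => ENNReal.ofReal (f g).re :=
    (Complex.measurable_re.comp (Lp.stronglyMeasurable f).measurable).ennreal_ofReal
  have h1 : (Measure.modularCharacterFun k : ℝ≥0∞) * ∫⁻ g in L, ENNReal.ofReal (f g).re ∂μ =
      ∫⁻ g, L.indicator (fun g => ENNReal.ofReal (f g).re) g ∂(μ.map (· * k)) := by
    rw [Measure.map_right_mul_eq_modularCharacterFun_smul, lintegral_smul_measure,
      lintegral_indicator hL.measurableSet]
    rfl
  rw [h1, lintegral_map (hF.indicator hL.measurableSet) (measurable_mul_const k),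
    ← lintegral_indicator (hL.mul hK.inv).measurableSet]
  refine lintegral_mono_ae ?_
  filter_upwards [coeFn_rightTranslate μ k f] with g hg
  by_cases h : g * k ∈ L
  · have h' : g ∈ L * K⁻¹ := ⟨g * k, h, k⁻¹, Set.inv_mem_inv.2 hk, by simp⟩
    rw [Set.indicator_of_mem h, Set.indicator_of_mem h', hg]
  · rw [Set.indicator_of_notMem h]
    exact zero_le

/-- If the action associated to `φ` is integrable, preimages of compact sets have finite measure. -/
theorem IsIntegrableAction.measure_preimage_lt_top [MeasurableSpace H] [BorelSpace H]
    (μ : Measure G) [μ.IsHaarMeasure] [μ.InnerRegular] (ν : Measure H) (φ : H →ₜ* G)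
    (hα : IsIntegrableAction μ ν (associatedAction μ φ)) {K : Set G} (hK : IsCompact K) :
    ν (φ ⁻¹' K) < ∞ := by
  obtain ⟨L, hL, hL1⟩ := exists_compact_mem_nhds (1 : G)
  obtain ⟨f, ⟨hfpos, y, -, hy⟩, hf⟩ := hα.exists_lintegral_ne_zero hL.measurableSet
    hL.measure_ne_top (Measure.measure_pos_of_mem_nhds μ hL1).ne'
  obtain ⟨c, hc0, hc⟩ := exists_le_modularCharacterFun μ hK
  have hM := hL.mul hK.inv
  set I := ∫⁻ g in L, ENNReal.ofReal (f g).re ∂μ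
  have hlow : c * I * ν (φ ⁻¹' K) ≤ weightValue μ ν (associatedAction μ φ) f
      (indicatorConstLp 1 hM.measurableSet hM.measure_ne_top (1 : ℂ)) := by
    have hm : MeasurableSet (φ ⁻¹' K) :=
      (hK.isClosed.preimage φ.continuous_toFun).measurableSet
    rw [← setLIntegral_const, weightValue]
    refine le_trans (setLIntegral_mono' hm fun h hh => ?_) (setLIntegral_le_lintegral _ _)
    rw [associatedAction, ofReal_pairing_indicatorConstLp _ _
      (rightTranslate_mem_LInfPos μ _ hfpos)]
    exact (mul_le_mul_left (hc _ hh) _).trans (le_setLIntegral_rightTranslate μ hL hK hh f)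
  rw [hy _ (indicatorConstLp_mem_LOnePos _ _)] at hlow
  by_contra htop
  rw [not_lt_top_iff.1 htop, ENNReal.mul_top (mul_ne_zero hc0 hf)] at hlow
  exact ENNReal.ofReal_ne_top (top_unique hlow)

/-- If the action associated to `φ` is integrable, then `φ` is proper. -/
theorem IsIntegrableAction.isProperMap [IsTopologicalGroup H] [LocallyCompactSpace H] [T2Space H]
    [MeasurableSpace H] [BorelSpace H]
    (μ : Measure G) [μ.IsHaarMeasure] [μ.InnerRegular] (ν : Measure H) [ν.IsHaarMeasure]
    (φ : H →ₜ* G) (hα : IsIntegrableAction μ ν (associatedAction μ φ)) : IsProperMap φ := by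
  refine isProperMap_iff_isCompact_preimage.2 ⟨φ.continuous_toFun, fun K hK => ?_⟩
  obtain ⟨V, hV, hV1⟩ := exists_compact_mem_nhds (1 : H)
  refine isCompact_of_measure_mul_lt_top ν (hK.isClosed.preimage φ.continuous_toFun) hV hV1 ?_
  -- `φ ⁻¹' K * V` lies in the preimage of the compact set `K * φ(V)`.
  refine lt_of_le_of_lt (measure_mono ?_)
    (hα.measure_preimage_lt_top μ ν φ (hK.mul (hV.image φ.continuous_toFun)))
  rintro _ ⟨s, hs, v, hv, rfl⟩
  exact ⟨φ s, hs, φ v, ⟨v, hv, rfl⟩, (map_mul φ s v).symm⟩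

end Closed

/-! ### Orbit integrals of a proper homomorphism and Tonelli's theorem -/

section Orbit

variable {G : Type*} [Group G] [TopologicalSpace G] [IsTopologicalGroup G]
  {H : Type*} [Group H] [TopologicalSpace H]

theorem continuous_orbit (φ : H →ₜ* G) {k : G → ℝ} (hk : Continuous k) :
    Continuous (Function.uncurry fun (g : G) (h : H) => k (g * φ h)) :=
  hk.comp (continuous_fst.mul (φ.continuous_toFun.comp continuous_snd))

omit [IsTopologicalGroup G] in
theorem orbit_eq_zero (φ : H →ₜ* G) {k : G → ℝ} {N : Set G} {g : G} (hg : g ∈ N) {h : H}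
    (hh : h ∉ φ ⁻¹' (N⁻¹ * tsupport k)) : k (g * φ h) = 0 := by
  by_contra hne
  exact hh ⟨g⁻¹, Set.inv_mem_inv.2 hg, g * φ h, subset_tsupport _ hne, by simp⟩

/-- For a proper homomorphism, the integral of a compactly supported continuous function along the
orbits `g * φ(H)` depends continuously on `g`. -/
theorem continuous_orbitIntegral [LocallyCompactSpace G] [MeasurableSpace H] [BorelSpace H]
    (ν : Measure H) [IsFiniteMeasureOnCompacts ν] (φ : H →ₜ* G) (hφ : IsProperMap φ) {k : G → ℝ}
    (hk : Continuous k) (hk' : HasCompactSupport k) :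
    Continuous fun g => ∫ h, k (g * φ h) ∂ν := by
  refine continuous_iff_continuousAt.2 fun g₀ => ?_
  obtain ⟨N, hN, hN1⟩ := exists_compact_mem_nhds g₀
  -- For all `g ∈ N` the integrand in `h` vanishes off this one set, compact by properness.
  have hc : IsCompact (φ ⁻¹' (N⁻¹ * tsupport k)) := hφ.isCompact_preimage (hN.inv.mul hk')
  exact (continuousOn_integral_of_compact_support hc (continuous_orbit φ hk).continuousOn
    (fun g h hg hh => orbit_eq_zero φ hg hh)).continuousAt hN1

/-- For a proper homomorphism, the integrals of a compactly supported continuous function along the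
orbits `g * φ(H)` are uniformly bounded. -/
theorem exists_abs_orbitIntegral_le [LocallyCompactSpace G] [IsTopologicalGroup H]
    [MeasurableSpace H] [BorelSpace H]
    (ν : Measure H) [IsFiniteMeasureOnCompacts ν] [ν.IsMulLeftInvariant]
    (φ : H →ₜ* G) (hφ : IsProperMap φ) {k : G → ℝ}
    (hk : Continuous k) (hk' : HasCompactSupport k) :
    ∃ C : ℝ, ∀ g, |∫ h, k (g * φ h) ∂ν| ≤ C := by
  obtain ⟨C, hC⟩ := hk'.isCompact.exists_bound_of_continuousOn
    (continuous_orbitIntegral ν φ hφ hk hk').continuousOn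
  refine ⟨max C 0, fun g => ?_⟩
  -- By left invariance the integral depends only on the orbit of `g`. Either the orbit misses the
  -- support or its base point can be moved into it, where compactness gives the bound.
  by_cases hg : ∃ h₀, g * φ h₀ ∈ tsupport k
  · obtain ⟨h₀, hh₀⟩ := hg
    have h1 : ∫ h, k (g * φ h) ∂ν = ∫ h, k (g * φ h₀ * φ h) ∂ν := by
      rw [← integral_mul_left_eq_self (fun h => k (g * φ h)) h₀]
      simp only [map_mul, mul_assoc]
    rw [h1]
    exact (hC _ hh₀).trans (le_max_left _ _)
  · push Not at hg
    have h1 : ∀ h, k (g * φ h) = 0 := fun h => image_eq_zero_of_notMem_tsupport (hg h)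
    simp [h1]

/-- Tonelli's theorem along orbits, for a finite measure concentrated on a compact set. -/
theorem lintegral_orbit_swap_of_isCompact [LocallyCompactSpace G] [T2Space G] [T2Space H]
    [MeasurableSpace G] [BorelSpace G] [MeasurableSpace H] [BorelSpace H]
    (m : Measure G) [IsFiniteMeasure m] {L : Set G} (hL : IsCompact L) (hmL : m Lᶜ = 0)
    (ν : Measure H) [IsFiniteMeasureOnCompacts ν] (φ : H →ₜ* G) (hφ : IsProperMap φ) {k : G → ℝ}
    (hk : Continuous k) (hk' : HasCompactSupport k) (hk0 : 0 ≤ k) :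
    Measurable (fun h => ∫⁻ g, ENNReal.ofReal (k (g * φ h)) ∂m) ∧
    ∫⁻ h, ∫⁻ g, ENNReal.ofReal (k (g * φ h)) ∂m ∂ν =
      ∫⁻ g, ENNReal.ofReal (∫ h, k (g * φ h) ∂ν) ∂m := by
  -- The cutoff `u` is `1` almost everywhere for `m`, so it changes no integral, but it makes the
  -- integrand compactly supported in both variables.
  obtain ⟨u, huL, -, hu, hu01⟩ :=
    exists_continuous_one_zero_of_isCompact hL isClosed_empty (Set.disjoint_empty L)
  have hu1 : ∀ᵐ g ∂m, u g = 1 := by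
    have : ∀ᵐ g ∂m, g ∈ L := hmL
    filter_upwards [this] with g hg using huL hg
  let F : H → G → ℝ := fun h g => u g * k (g * φ h)
  have hF0 : ∀ h g, 0 ≤ F h g := fun h g => mul_nonneg (hu01 g).1 (hk0 _)
  have hFc : Continuous F.uncurry :=
    (u.continuous.comp continuous_snd).mul ((continuous_orbit φ hk).comp continuous_swap)
  have hc : IsCompact (φ ⁻¹' ((tsupport u)⁻¹ * tsupport k)) :=
    hφ.isCompact_preimage (hu.isCompact.inv.mul hk')
  have hF1 : ∀ h g, F h g ≠ 0 → h ∈ φ ⁻¹' ((tsupport u)⁻¹ * tsupport k) ∧ g ∈ tsupport u := by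
    intro h g hne
    have hg : g ∈ tsupport u := subset_tsupport _ (left_ne_zero_of_mul hne)
    refine ⟨?_, hg⟩
    by_contra hh
    exact right_ne_zero_of_mul hne (orbit_eq_zero φ hg hh)
  have hFs : HasCompactSupport F.uncurry :=
    HasCompactSupport.of_support_subset_isCompact (hc.prod hu.isCompact)
      fun p hp => hF1 p.1 p.2 hp
  have hmF : ∀ h, ∫⁻ g, ENNReal.ofReal (k (g * φ h)) ∂m = ENNReal.ofReal (∫ g, F h g ∂m) := by
    intro h
    rw [ofReal_integral_eq_lintegral_ofReal _ (ae_of_all _ (hF0 h))]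
    · refine lintegral_congr_ae ?_
      filter_upwards [hu1] with g hg
      simp [F, hg]
    · refine Continuous.integrable_of_hasCompactSupport
        (hFc.comp (continuous_const.prodMk continuous_id)) ?_
      exact HasCompactSupport.of_support_subset_isCompact hu.isCompact
        fun g hg => (hF1 h g hg).2
  have hcont : Continuous fun h => ∫ g, F h g ∂m := by
    refine continuousOn_univ.1 (continuousOn_integral_of_compact_support hu.isCompact
      hFc.continuousOn fun h g _ hg => ?_)
    by_contra hne
    exact hg (hF1 h g hne).2
  have hint : Integrable (fun h => ∫ g, F h g ∂m) ν := by
    refine hcont.integrable_of_hasCompactSupport ?_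
    refine HasCompactSupport.of_support_subset_isCompact hc fun h hh => ?_
    by_contra hne
    refine hh (integral_eq_zero_of_ae (ae_of_all _ fun g => ?_))
    by_contra hg
    exact hne (hF1 h g hg).1
  refine ⟨by simp_rw [hmF]; exact hcont.measurable.ennreal_ofReal, ?_⟩
  simp_rw [hmF]
  rw [← ofReal_integral_eq_lintegral_ofReal hint
    (ae_of_all _ fun h => integral_nonneg (hF0 h)),
    integral_integral_swap_of_hasCompactSupport hFc hFs]
  simp only [F, integral_const_mul]
  have hy := continuous_orbitIntegral ν φ hφ hk hk'
  rw [ofReal_integral_eq_lintegral_ofReal]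
  · refine lintegral_congr_ae ?_
    filter_upwards [hu1] with g hg
    simp [hg]
  · exact (u.continuous.mul hy).integrable_of_hasCompactSupport hu.mul_right
  · exact ae_of_all _ fun g => mul_nonneg (hu01 g).1 (integral_nonneg fun h => hk0 _)

/-- A finite inner regular measure is a countable sum of finite measures concentrated on
compact sets. -/
theorem exists_eq_sum_isCompact {X : Type*} [TopologicalSpace X] [T2Space X] [MeasurableSpace X]
    [OpensMeasurableSpace X] (m : Measure X) [IsFiniteMeasure m] [m.InnerRegular] :
    ∃ (K : ℕ → Set X) (D : ℕ → Set X), (∀ n, IsCompact (K n)) ∧ (∀ n, D n ⊆ K n) ∧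
      (∀ n, MeasurableSet (D n)) ∧ m = Measure.sum fun n => m.restrict (D n) := by
  have hex : ∀ n : ℕ, ∃ K, IsCompact K ∧ m Kᶜ < ((n : ℝ≥0∞) + 1)⁻¹ := by
    intro n
    obtain ⟨K, -, hK, hlt⟩ := MeasurableSet.univ.exists_isCompact_sdiff_lt (measure_ne_top m _)
      (ENNReal.inv_ne_zero.2 (by finiteness : ((n : ℝ≥0∞) + 1) ≠ ∞))
    exact ⟨K, hK, by rwa [Set.compl_eq_univ_sdiff]⟩
  choose K hK hlt using hex
  have hDm : ∀ n, MeasurableSet (disjointed K n) :=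
    fun n => .disjointed (fun i => (hK i).measurableSet) n
  refine ⟨K, disjointed K, hK, disjointed_subset K, hDm, ?_⟩
  rw [← Measure.restrict_iUnion (disjoint_disjointed K) hDm, iUnion_disjointed, eq_comm,
    Measure.restrict_eq_self_of_ae_mem]
  change m (⋃ n, K n)ᶜ = 0
  by_contra hne
  obtain ⟨n, hn⟩ := ENNReal.exists_inv_nat_lt hne
  refine hn.not_ge ?_
  calc m (⋃ n, K n)ᶜ ≤ m (K n)ᶜ :=
        measure_mono (Set.compl_subset_compl.2 (Set.subset_iUnion K n))
    _ ≤ ((n : ℝ≥0∞) + 1)⁻¹ := (hlt n).le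
    _ ≤ (n : ℝ≥0∞)⁻¹ := ENNReal.inv_le_inv.2 le_self_add

/-- Tonelli's theorem along orbits, for a finite inner regular measure. -/
theorem lintegral_orbit_swap [LocallyCompactSpace G] [T2Space G] [T2Space H]
    [MeasurableSpace G] [BorelSpace G] [MeasurableSpace H] [BorelSpace H]
    (m : Measure G) [IsFiniteMeasure m] [m.InnerRegular]
    (ν : Measure H) [IsFiniteMeasureOnCompacts ν] (φ : H →ₜ* G) (hφ : IsProperMap φ) {k : G → ℝ}
    (hk : Continuous k) (hk' : HasCompactSupport k) (hk0 : 0 ≤ k) :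
    ∫⁻ h, ∫⁻ g, ENNReal.ofReal (k (g * φ h)) ∂m ∂ν =
      ∫⁻ g, ENNReal.ofReal (∫ h, k (g * φ h) ∂ν) ∂m := by
  obtain ⟨K, D, hK, hDK, hD, hm⟩ := exists_eq_sum_isCompact m
  have hsum := fun n => lintegral_orbit_swap_of_isCompact (m.restrict (D n)) (hK n)
    (by rw [Measure.restrict_apply (hK n).measurableSet.compl,
          (Set.disjoint_compl_left_iff_subset.2 (hDK n)).inter_eq, measure_empty])
    ν φ hφ hk hk' hk0
  rw [hm]
  simp_rw [lintegral_sum_measure]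
  rw [lintegral_tsum fun n => (hsum n).1.aemeasurable]
  exact tsum_congr fun n => (hsum n).2

end Orbit

/-! ### The pairing and the `σ`-weak topology -/

section Pairing

variable {G : Type*} [MeasurableSpace G] {μ : Measure G}

theorem integrable_mul_LOne_LInf (ω : LOne μ) (f : LInf μ) :
    Integrable (fun g => ω g * f g) μ :=
  (Lp.memLp ω).integrable_mul (Lp.memLp f)

/-- The pairing of positive elements as an integral against the measure with density `‖ω‖`. -/
theorem ofReal_pairing_eq_lintegral_withDensity {ω : LOne μ} (hω : ω ∈ LOnePos μ) {f : LInf μ}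
    {u : G → ℝ} (hu : Measurable u) (hu0 : 0 ≤ u) (hfu : f =ᵐ[μ] fun g => (u g : ℂ)) :
    ENNReal.ofReal (pairing μ ω f).re =
      ∫⁻ g, ENNReal.ofReal (u g) ∂(μ.withDensity fun g => ‖ω g‖ₑ) := by
  have hae : (fun g => ω g * f g) =ᵐ[μ] fun g => ((‖ω g‖ * u g : ℝ) : ℂ) := by
    filter_upwards [hω, hfu] with g h1 h2
    rw [h2, Complex.ofReal_mul, ← Complex.eq_coe_norm_of_nonneg h1]
  have hint : Integrable (fun g => ‖ω g‖ * u g) μ := by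
    refine ((integrable_mul_LOne_LInf ω f).congr hae).re.congr (ae_of_all _ fun g => ?_)
    exact Complex.ofReal_re _
  have h1 : pairing μ ω f = ((∫ g, ‖ω g‖ * u g ∂μ : ℝ) : ℂ) := by
    rw [pairing, integral_congr_ae hae]
    exact integral_ofReal
  rw [h1, Complex.ofReal_re, ofReal_integral_eq_lintegral_ofReal hint
    (ae_of_all _ fun g => mul_nonneg (norm_nonneg _) (hu0 g)),
    lintegral_withDensity_eq_lintegral_mul μ (Lp.stronglyMeasurable ω).measurable.enorm
      hu.ennreal_ofReal]
  refine lintegral_congr fun g => ?_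
  rw [Pi.mul_apply, ENNReal.ofReal_mul (norm_nonneg _), ofReal_norm]

theorem lintegral_enorm_LOne_ne_top (ω : LOne μ) : ∫⁻ g, ‖ω g‖ₑ ∂μ ≠ ∞ :=
  (memLp_one_iff_integrable.1 (Lp.memLp ω)).2.ne

/-- A membership criterion for the `σ`-weak closure. -/
theorem mem_closure_sigmaWeak {S : Set (LInf μ)} {f : LInf μ}
    (h : ∀ (I : Finset (LOne μ)) (ε : ℝ), 0 < ε →
      ∃ k ∈ S, ∀ ω ∈ I, ‖pairing μ ω k - pairing μ ω f‖ < ε) :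
    f ∈ @closure (LInf μ) (sigmaWeak μ) S := by
  rw [sigmaWeak, closure_induced, mem_closure_iff_nhds]
  intro t ht
  rw [nhds_pi, Filter.mem_pi] at ht
  obtain ⟨I, hI, s, hs, hst⟩ := ht
  have hev : ∀ᶠ ε : ℝ in 𝓝[>] 0, ∀ ω ∈ I, Metric.ball (pairing μ ω f) ε ⊆ s ω := by
    refine (eventually_all_finite hI).2 fun ω _ => ?_
    obtain ⟨δ, hδ, hball⟩ := Metric.mem_nhds_iff.1 (hs ω)
    filter_upwards [Ioo_mem_nhdsGT hδ] with ε hε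
    exact (Metric.ball_subset_ball hε.2.le).trans hball
  obtain ⟨ε, hε, hε0⟩ := (hev.and self_mem_nhdsWithin).exists
  obtain ⟨k, hk, hkI⟩ := h hI.toFinset ε hε0
  refine ⟨_, hst fun ω hω => hε ω hω ?_, k, hk, rfl⟩
  rw [Metric.mem_ball, dist_eq_norm]
  exact hkI ω (hI.mem_toFinset.2 hω)

end Pairing

/-! ### Density of compactly supported continuous functions -/

section Dense

variable {G : Type*} [TopologicalSpace G] [MeasurableSpace G] [BorelSpace G] {μ : Measure G}

/-- A compactly supported continuous function as an element of `L^∞(G)`. -/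
theorem memLp_top_ofReal_of_hasCompactSupport {k : G → ℝ} (hk : Continuous k)
    (hk' : HasCompactSupport k) : MemLp (fun g => (k g : ℂ)) ∞ μ := by
  obtain ⟨C, hC⟩ := hk'.exists_bound_of_continuous hk
  exact memLp_top_of_bound (Complex.measurable_ofReal.comp hk.measurable).aestronglyMeasurable C
    (ae_of_all _ fun g => by simpa using hC g)

/-- In a locally compact Hausdorff space, functions in `ℒᵖ` of a regular measure can be approximated
by compactly supported continuous functions; normality of the space is not needed. -/
theorem exists_hasCompactSupport_eLpNorm_sub_le [T2Space G] [LocallyCompactSpace G] [μ.Regular]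
    {E : Type*} [NormedAddCommGroup E] [NormedSpace ℝ E] {p : ℝ≥0∞} (hp : p ≠ ∞) {f : G → E}
    (hf : MemLp f p μ) {ε : ℝ≥0∞} (hε : ε ≠ 0) :
    ∃ k : G → E, HasCompactSupport k ∧ eLpNorm (f - k) p μ ≤ ε ∧ Continuous k := by
  suffices H : ∃ k : G → E, eLpNorm (f - k) p μ ≤ ε ∧ Continuous k ∧
      AEStronglyMeasurable k μ ∧ HasCompactSupport k by
    obtain ⟨k, h1, h2, -, h3⟩ := H
    exact ⟨k, h3, h1, h2⟩
  apply hf.induction_dense hp _ _ _ _ hε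
  rotate_left
  · rintro f g ⟨hf1, hf2, hf3⟩ ⟨hg1, hg2, hg3⟩
    exact ⟨hf1.add hg1, hf2.add hg2, hf3.add hg3⟩
  · rintro f ⟨-, h, -⟩
    exact h
  intro c t ht htμ ε hε
  obtain ⟨η, hη0, hη⟩ := exists_eLpNorm_indicator_le (μ := μ) hp c hε
  have hη2 : (η : ℝ≥0∞) / 2 ≠ 0 := (ENNReal.half_pos (by simpa using hη0.ne')).ne'
  obtain ⟨s, hst, hs, hsμ⟩ := ht.exists_isCompact_sdiff_lt htμ.ne hη2
  -- `V` surrounds the compact `s`, not `t`; a Urysohn function between `s` and `V` differs from the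
  -- indicator of `t` only on the two small sets `V \ s` and `t \ s`.
  obtain ⟨V, hsV, hV, -, hVμ⟩ :=
    hs.measurableSet.exists_isOpen_sdiff_lt (hs.measure_ne_top (μ := μ)) hη2
  obtain ⟨u, hus, huV, hu, hu01⟩ := exists_continuous_one_zero_of_isCompact hs
    hV.isClosed_compl (Set.disjoint_compl_right_iff_subset.2 hsV)
  have huc : Continuous fun x => u x • c := u.continuous.smul continuous_const
  refine ⟨fun x => u x • c, ?_, huc, ?_, hu.smul_right⟩
  · refine le_trans (eLpNorm_mono fun x => ?_) (hη (V \ s ∪ t \ s) ?_)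
    · by_cases hxs : x ∈ s
      · simp [hus hxs, hst hxs]
      by_cases hxm : x ∈ V \ s ∪ t \ s
      · rw [Set.indicator_of_mem hxm]
        obtain ⟨h0, h1⟩ := hu01 x
        by_cases hxt : x ∈ t
        · have h2 : u x • c - c = (u x - 1) • c := by rw [sub_smul, one_smul]
          rw [Pi.sub_apply, Set.indicator_of_mem hxt, h2, norm_smul]
          refine mul_le_of_le_one_left (norm_nonneg _) ?_
          rw [Real.norm_eq_abs, abs_le]
          constructor <;> linarith
        · rw [Pi.sub_apply, Set.indicator_of_notMem hxt, sub_zero, norm_smul]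
          refine mul_le_of_le_one_left (norm_nonneg _) ?_
          rwa [Real.norm_eq_abs, abs_of_nonneg h0]
      · have hxV : x ∉ V := fun h => hxm (Or.inl ⟨h, hxs⟩)
        have hxt : x ∉ t := fun h => hxm (Or.inr ⟨h, hxs⟩)
        simp [huV hxV, hxt]
    · calc μ (V \ s ∪ t \ s) ≤ μ (V \ s) + μ (t \ s) := measure_union_le _ _
        _ ≤ (η : ℝ≥0∞) / 2 + (η : ℝ≥0∞) / 2 := add_le_add hVμ.le hsμ.le
        _ = η := ENNReal.add_halves _
  · exact u.continuous.aestronglyMeasurable.smul_const c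

/-- Nonnegative compactly supported continuous functions are `σ`-weakly dense in the positive cone
of `L^∞(G)`. -/
theorem exists_hasCompactSupport_pairing_sub_lt [T2Space G] [LocallyCompactSpace G]
    [μ.InnerRegular] {f : LInf μ} (hf : f ∈ LInfPos μ) (I : Finset (LOne μ)) {ε : ℝ}
    (hε : 0 < ε) :
    ∃ (k : G → ℝ) (hk : Continuous k) (hk' : HasCompactSupport k), 0 ≤ k ∧
      ∀ ω ∈ I, ‖pairing μ ω ((memLp_top_ofReal_of_hasCompactSupport hk hk').toLp _) -
        pairing μ ω f‖ < ε := by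
  -- `F` dominates every `|ω|` with `ω ∈ I`, so a single `L¹` approximation for the finite measure
  -- `F μ` controls all the pairings at once.
  let F : G → ℝ≥0∞ := fun g => ∑ ω ∈ I, ‖ω g‖ₑ
  have hF : Measurable F :=
    Finset.measurable_sum _ fun ω _ => (Lp.stronglyMeasurable ω).measurable.enorm
  have hFfin : ∫⁻ g, F g ∂μ ≠ ∞ := by
    rw [lintegral_finsetSum _ fun ω _ => (Lp.stronglyMeasurable ω).measurable.enorm]
    exact (ENNReal.sum_lt_top.2 fun ω _ => (lintegral_enorm_LOne_ne_top ω).lt_top).ne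
  have : IsFiniteMeasure (μ.withDensity F) := isFiniteMeasure_withDensity hFfin
  have : (μ.withDensity F).InnerRegular := innerRegular_withDensity μ hF hFfin
  have hfint : Integrable (fun g => (f g).re) (μ.withDensity F) := by
    have h1 : MemLp (fun g => f g) ∞ (μ.withDensity F) := by
      refine ⟨(Lp.stronglyMeasurable f).aestronglyMeasurable, ?_⟩
      exact (essSup_mono_measure (withDensity_absolutelyContinuous μ F)).trans_lt (Lp.eLpNorm_lt_top f)
    exact (h1.integrable le_top).re
  obtain ⟨k₀, hk₀s, hk₀, hk₀c⟩ := exists_hasCompactSupport_eLpNorm_sub_le ENNReal.one_ne_top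
    (memLp_one_iff_integrable.2 hfint) (ENNReal.ofReal_pos.2 (half_pos hε)).ne'
  have hkc : Continuous fun g => max (k₀ g) 0 := hk₀c.max continuous_const
  have hks : HasCompactSupport fun g => max (k₀ g) 0 :=
    hk₀s.comp_left (g := fun x : ℝ => max x 0) (by simp)
  refine ⟨_, hkc, hks, fun g => le_max_right _ _, fun ω hω => ?_⟩
  set κ : LInf μ := (memLp_top_ofReal_of_hasCompactSupport hkc hks).toLp _
  have hκ : κ =ᵐ[μ] fun g => ((max (k₀ g) 0 : ℝ) : ℂ) := MemLp.coeFn_toLp _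
  have hmeas : Measurable fun g => ‖(f g).re - k₀ g‖ₑ :=
    ((Complex.measurable_re.comp (Lp.stronglyMeasurable f).measurable).sub hk₀c.measurable).enorm
  have hle : ‖pairing μ ω κ - pairing μ ω f‖ₑ ≤ ENNReal.ofReal (ε / 2) := by
    calc ‖pairing μ ω κ - pairing μ ω f‖ₑ
        = ‖∫ g, (ω g * κ g - ω g * f g) ∂μ‖ₑ := by
          rw [integral_sub (integrable_mul_LOne_LInf ω κ) (integrable_mul_LOne_LInf ω f)]
          rfl
      _ ≤ ∫⁻ g, ‖ω g * κ g - ω g * f g‖ₑ ∂μ := enorm_integral_le_lintegral_enorm _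
      _ ≤ ∫⁻ g, F g * ‖(f g).re - k₀ g‖ₑ ∂μ := by
          refine lintegral_mono_ae ?_
          filter_upwards [hκ, hf] with g h1 h2
          rw [h1, ← mul_sub, enorm_mul]
          refine mul_le_mul' (Finset.single_le_sum (f := fun ω : LOne μ => ‖ω g‖ₑ)
            (fun _ _ => zero_le) hω) ?_
          have h3 := Complex.le_def.1 h2
          have h4 : f g = (((f g).re : ℝ) : ℂ) := Complex.ext rfl h3.2.symm
          rw [h4, ← Complex.ofReal_sub, Complex.ofReal_re, ← ofReal_norm, ← ofReal_norm,
            Complex.norm_real, Real.norm_eq_abs, Real.norm_eq_abs, abs_sub_comm]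
          refine ENNReal.ofReal_le_ofReal ?_
          -- Since `f ≥ 0`, replacing `k₀` by its positive part does not increase the error.
          have h5 : max (f g).re 0 = (f g).re := max_eq_left h3.1
          calc |(f g).re - max (k₀ g) 0| = |max (f g).re 0 - max (k₀ g) 0| := by rw [h5]
            _ ≤ _ := abs_max_sub_max_le_abs _ _ _
      _ = ∫⁻ g, ‖(f g).re - k₀ g‖ₑ ∂(μ.withDensity F) := by
          rw [lintegral_withDensity_eq_lintegral_mul μ hF hmeas]
          rfl
      _ = eLpNorm ((fun g => (f g).re) - k₀) 1 (μ.withDensity F) :=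
          eLpNorm_one_eq_lintegral_enorm.symm
      _ ≤ _ := hk₀
  rw [← ofReal_norm] at hle
  have := (ENNReal.ofReal_le_ofReal_iff (half_pos hε).le).1 hle
  linarith

end Dense

/-! ### Proper homomorphisms give integrable actions -/

section Proper

variable {G : Type*} [Group G] [TopologicalSpace G] [IsTopologicalGroup G]
  [LocallyCompactSpace G] [T2Space G] [MeasurableSpace G] [BorelSpace G]
  {H : Type*} [Group H] [TopologicalSpace H] [IsTopologicalGroup H] [T2Space H]
  [MeasurableSpace H] [BorelSpace H]

/-- For a proper homomorphism, nonnegative compactly supported continuous functions are integrable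
elements of the associated action. -/
theorem toLp_mem_integrableElements (μ : Measure G) [μ.IsHaarMeasure] [μ.InnerRegular]
    (ν : Measure H) [IsFiniteMeasureOnCompacts ν] [ν.IsMulLeftInvariant] (φ : H →ₜ* G)
    (hφ : IsProperMap φ) {k : G → ℝ} (hk : Continuous k) (hk' : HasCompactSupport k)
    (hk0 : 0 ≤ k) :
    (memLp_top_ofReal_of_hasCompactSupport hk hk').toLp _ ∈
      integrableElements μ ν (associatedAction μ φ) := by
  set κ : LInf μ := (memLp_top_ofReal_of_hasCompactSupport hk hk').toLp _
  have hκ : κ =ᵐ[μ] fun g => (k g : ℂ) := MemLp.coeFn_toLp _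
  have hyc := continuous_orbitIntegral ν φ hφ hk hk'
  obtain ⟨C, hC⟩ := exists_abs_orbitIntegral_le ν φ hφ hk hk'
  have hyL : MemLp (fun g => ((∫ h, k (g * φ h) ∂ν : ℝ) : ℂ)) ∞ μ :=
    memLp_top_of_bound (Complex.measurable_ofReal.comp hyc.measurable).aestronglyMeasurable C
      (ae_of_all _ fun g => by simpa using hC g)
  have hy0 : 0 ≤ fun g => ∫ h, k (g * φ h) ∂ν := fun g => integral_nonneg fun h => hk0 _
  -- The witness `y` is the class of the orbit integral of `k`.
  refine ⟨?_, hyL.toLp _, ?_, fun ω hω => ?_⟩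
  · filter_upwards [hκ] with g hg
    rw [hg]
    exact Complex.zero_le_real.2 (hk0 g)
  · filter_upwards [hyL.coeFn_toLp] with g hg
    rw [hg]
    exact Complex.zero_le_real.2 (hy0 g)
  · have hωm : Measurable fun g => ‖ω g‖ₑ := (Lp.stronglyMeasurable ω).measurable.enorm
    have : IsFiniteMeasure (μ.withDensity fun g => ‖ω g‖ₑ) :=
      isFiniteMeasure_withDensity (lintegral_enorm_LOne_ne_top ω)
    have : (μ.withDensity fun g => ‖ω g‖ₑ).InnerRegular :=
      innerRegular_withDensity μ hωm (lintegral_enorm_LOne_ne_top ω)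
    rw [ofReal_pairing_eq_lintegral_withDensity hω hyc.measurable hy0 hyL.coeFn_toLp,
      ← lintegral_orbit_swap _ ν φ hφ hk hk' hk0, weightValue]
    refine lintegral_congr fun h => ?_
    have hkh : Continuous fun g => k (g * φ h) := hk.comp (continuous_mul_const _)
    refine ofReal_pairing_eq_lintegral_withDensity hω hkh.measurable (fun g => hk0 (g * φ h)) ?_
    filter_upwards [coeFn_rightTranslate μ (φ h) κ,
      (quasiMeasurePreserving_mul_const μ (φ h)).ae hκ] with g h1 h2
    exact h1.trans h2

/-- The action associated to a proper homomorphism is integrable. -/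
theorem isIntegrableAction_of_isProperMap (μ : Measure G) [μ.IsHaarMeasure] [μ.InnerRegular]
    (ν : Measure H) [IsFiniteMeasureOnCompacts ν] [ν.IsMulLeftInvariant] (φ : H →ₜ* G)
    (hφ : IsProperMap φ) : IsIntegrableAction μ ν (associatedAction μ φ) := by
  refine fun f hf => mem_closure_sigmaWeak fun I ε hε => ?_
  obtain ⟨k, hk, hk', hk0, hI⟩ := exists_hasCompactSupport_pairing_sub_lt hf I hε
  exact ⟨_, toLp_mem_integrableElements μ ν φ hφ hk hk' hk0, hI⟩

end Proper

end LCG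

theorem mainTheorem7
    {G : Type*} [Group G] [TopologicalSpace G] [IsTopologicalGroup G] [LocallyCompactSpace G]
    [T2Space G] [MeasurableSpace G] [BorelSpace G]
    {H : Type*} [Group H] [TopologicalSpace H] [IsTopologicalGroup H] [LocallyCompactSpace H]
    [T2Space H] [MeasurableSpace H] [BorelSpace H]
    (μ : Measure G) [μ.IsHaarMeasure] [μ.InnerRegular]
    (ν : Measure H) [ν.IsHaarMeasure] [ν.InnerRegular]
    (φ : H →ₜ* G) (hφ : Function.Injective φ) :
    (IsClosed (Set.range φ) ∧ Topology.IsEmbedding φ) ↔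
      LCG.IsIntegrableAction μ ν (LCG.associatedAction μ φ) := by
  constructor
  · rintro ⟨hclosed, hemb⟩
    exact LCG.isIntegrableAction_of_isProperMap μ ν φ
      (Topology.IsClosedEmbedding.mk hemb hclosed).isProperMap
  · intro hα
    have hproper := hα.isProperMap μ ν φ
    have h := Topology.IsClosedEmbedding.of_continuous_injective_isClosedMap
      hproper.continuous hφ hproper.isClosedMap
    exact ⟨h.isClosed_range, h.isEmbedding⟩
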